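/- For a complex modulus $k$ let $\mathrm{sn},\mathrm{cn},\mathrm{dn}$ be the Jacobi elliptic functions: the unique meromorphic functions on $\mathbb{C}$ such that near $0$ the function $\mathrm{sn}(\cdot,k)$ inverts $x\mapsto\int_0^x\frac{dt}{\sqrt{(1-t^2)(1-k^2t^2)}}$, $\mathrm{cn}=\sqrt{1-\mathrm{sn}^2}$ and $\mathrm{dn}=\sqrt{1-k^2\mathrm{sn}^2}$ (principal roots). For complex $z_*$, $\nu_1,\nu_2,\nu_3,\alpha,\beta,q$ consider Heun's equation $$y''+\Big[\frac{2\nu_1+1}{z}+\frac{2\nu_2+1}{z-1}+\frac{2\nu_3+1}{z-z_*}\Big]y'+\frac{\alpha\beta z-q}{z(z-1)(z-z_*)}\,y=0\qquad(\mathrm{H})$$ and the Jacobian elliptic (Darboux) form $$\frac{d^2Y}{du^2}+\Big[(4\nu_1+1)\frac{\mathrm{cn}\,u\,\mathrm{dn}\,u}{\mathrm{sn}\,u}-(4\nu_2+1)\frac{\mathrm{sn}\,u\,\mathrm{dn}\,u}{\mathrm{cn}\,u}-k^2(4\nu_3+1)\frac{\mathrm{sn}\,u\,\mathrm{cn}\,u}{\mathrm{dn}\,u}\Big]\frac{dY}{du}+\big(4\alpha\beta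 k^2\mathrm{sn}^2u-4k^2q\big)Y=0.\qquad(\mathrm{J})$$ In each of the two cases below, let $k\in\mathbb{C}$ satisfy $k^{-2}=z_*$, and let $u\in\mathbb{C}$ be a point at which $\mathrm{sn},\mathrm{cn},\mathrm{dn}$ are finite and nonzero. Then $v\mapsto\mathrm{sn}^2(v,k)$ is holomorphic at $u$ with nonzero derivative there, and for every function $y$ holomorphic at $\mathrm{sn}^2(u,k)$: $y$ satisfies $(\mathrm{H})$ at $z=\mathrm{sn}^2(u,k)$ if and only if $Y(v)=y(\mathrm{sn}^2(v,k))$ satisfies $(\mathrm{J})$ at $u$. Throughout, $\Lambda>0$ is the cosmological constant, $a$ the Kerr parameter, $\alpha_\Lambda=\Xi-1=a^2\Lambda/3$, $m\in\mathbb{Z}$, $\omega\in\mathbb{C}$. **Radial case** (Kerr--Newman--de Sitter black hole with mass $M$ and charge $e$; scalar particle of charge $q_s$; $a,M,e,q_s\in\mathbb{R}$). Suppose $$\Big(1-\frac{\Lambda}{3}r^2\Big)(r^2+a^2)-2Mr+e^2=-\frac{\Lambda}{3}(r-r_+)(r-r_-)(r-r_\Lambda^+)(r-r_\Lambda^-)$$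 with pairwise distinct real roots. Put $K(r)=\omega(r^2+a^2)-am$ and $$z_*=z_r=\frac{r_+-r_\Lambda^-}{r_+-r_-}\cdot\frac{r_\Lambda^+-r_-}{r_\Lambda^+-r_\Lambda^-}.$$ The exponents are $\nu_i=\mu_i$ with $$\mu_1=\pm\frac{3i}{\Lambda}\frac{\Xi K(r_-)-eq_sr_-}{(r_\Lambda^--r_-)(r_+-r_-)(r_\Lambda^+-r_-)},\quad \mu_2=\pm\frac{3i}{\Lambda}\frac{\Xi K(r_+)-eq_sr_+}{(r_\Lambda^--r_+)(r_--r_+)(r_\Lambda^+-r_+)},\quad \mu_3=\pm\frac{3i}{\Lambda}\frac{\Xi K(r_\Lambda^+)-eq_sr_\Lambda^+}{(r_\Lambda^--r_\Lambda^+)(r_+-r_\Lambda^+)(r_--r_\Lambda^+)}$$ (signs chosen independently), and $\alpha,\beta,q\in\mathbb{C}$ are arbitrary. **Angular case** ($a\in\mathbb{R}$, $a\neq0$, separation constant $K_{lm}\in\mathbb{C}$). Put $s=\sqrt{\alpha_\Lambda}$ and $$z_*=z_3=-\frac12\Big(-1+\frac{\alpha_\Lambda-1}{2is}\Big).$$ The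 exponents are $\nu_i=\alpha_i$ with $\alpha_1=\alpha_2=\frac{|m|}{2}$, $\alpha_3=\pm\frac i2\big(\frac{\Xi a\omega}{s}-ms\big)$, and $$q=\frac{i}{4s}\Big\{-(1+is)^2[2\alpha_1\alpha_2+\alpha_2+\alpha_1]-4si[2\alpha_1\alpha_3+\alpha_3+\alpha_1]-\frac{m^2}{2}\big((1+is)^2+4\alpha_\Lambda\big)+K_{lm}-2is+2\Xi ma\omega\Big\},$$ $$\alpha\beta=q+\frac{i}{4s}\Big\{\frac{m^2}{2}\big((1-is)^2+4\alpha_\Lambda\big)-2ma\omega\Xi-K_{lm}-2si+(1-is)^2[2\alpha_1\alpha_2+\alpha_2+\alpha_1]+4is(-2\alpha_2\alpha_3-\alpha_3-\alpha_2)\Big\}.$$ -/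

import Mathlib

namespace JacobiElliptic

noncomputable section

open Filter Topology Set

/-- The integrand `1 / √((1 - x²)(1 - k²x²))` of Legendre's elliptic integral of the first kind. -/
def ellipticIntegrand (k x : ℂ) : ℂ :=
  1 / (Complex.sqrt (1 - x ^ 2) * Complex.sqrt (1 - k ^ 2 * x ^ 2))

/-- Legendre's (Jacobi's form of the) elliptic integral of the first kind
`F(x, k) = ∫₀ˣ dt / √((1 - t²)(1 - k²t²))`, along the segment from `0` to `x`; only its germ at
`x = 0` is used, where the principal square roots are holomorphic. -/
def ellipticF (k x : ℂ) : ℂ :=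
  ∫ t in (0 : ℝ)..1, x * ellipticIntegrand k (t * x)

/-- `s, c, d` are the Jacobi elliptic functions `sn, cn, dn` of modulus `k`: the meromorphic
functions on `ℂ` such that, near the origin, `sn` inverts the elliptic integral of the first kind,
`cn = √(1 - sn²)` and `dn = √(1 - k² sn²)`. Normal form means that removable singularities are
removed and that the value at a pole is `0`. -/
structure IsJacobiTriple (k : ℂ) (s c d : ℂ → ℂ) : Prop where
  meromorphic_sn : MeromorphicNFOn s univ
  meromorphic_cn : MeromorphicNFOn c univ
  meromorphic_dn : MeromorphicNFOn d univ
  sn_ellipticF : ∀ᶠ x in 𝓝 (0 : ℂ), s (ellipticF k x) = x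
  cn_eq : ∀ᶠ u in 𝓝 (0 : ℂ), c u = Complex.sqrt (1 - s u ^ 2)
  dn_eq : ∀ᶠ u in 𝓝 (0 : ℂ), d u = Complex.sqrt (1 - k ^ 2 * s u ^ 2)

lemma sqrt_mul_self' (z : ℂ) : Complex.sqrt z ^ 2 = z := by
  simp [Complex.sqrt]

lemma sqrt_sq_of_re_pos {w : ℂ} (hw : 0 < w.re) : Complex.sqrt (w ^ 2) = w := by
  simpa [Complex.sqrt] using Complex.sq_cpow_two_inv hw

lemma sqrt_analyticAt {z : ℂ} (hz : z ∈ Complex.slitPlane) : AnalyticAt ℂ Complex.sqrt z :=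
  Complex.differentiableOn_sqrt.analyticAt (Complex.isOpen_slitPlane.mem_nhds hz)

lemma sqrt_ne_zero_of_slit {z : ℂ} (hz : z ∈ Complex.slitPlane) : Complex.sqrt z ≠ 0 := by
  intro h
  have := sqrt_mul_self' z
  rw [h] at this
  exact Complex.slitPlane_ne_zero hz (by simpa using this.symm)

lemma slit_nhds (k : ℂ) : ∀ᶠ x in 𝓝 (0 : ℂ), 1 - k * x ^ 2 ∈ Complex.slitPlane := by
  have h : ContinuousAt (fun x : ℂ => 1 - k * x ^ 2) 0 := by fun_prop
  exact h.eventually_mem (Complex.isOpen_slitPlane.mem_nhds (by simp))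

/-- Near `0` the elliptic integral is a primitive of its integrand -/
lemma hasDerivAt_ellipticF (k : ℂ) :
    ∀ᶠ x in 𝓝 (0 : ℂ), HasDerivAt (ellipticF k) (ellipticIntegrand k x) x := by
  obtain ⟨R, hR, hb⟩ := Metric.eventually_nhds_iff_ball.1
    ((slit_nhds 1).and (slit_nhds (k ^ 2)))
  have hd : DifferentiableOn ℂ (ellipticIntegrand k) (Metric.ball 0 R) := by
    intro x hx
    obtain ⟨h1, h2⟩ := hb x hx
    rw [one_mul] at h1
    have a1 : DifferentiableAt ℂ (fun x : ℂ => Complex.sqrt (1 - x ^ 2)) x :=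
      DifferentiableAt.comp (g := Complex.sqrt) (f := fun x : ℂ => 1 - x ^ 2) x
        (Complex.differentiableAt_sqrt h1) (by fun_prop)
    have a2 : DifferentiableAt ℂ (fun x : ℂ => Complex.sqrt (1 - k ^ 2 * x ^ 2)) x :=
      DifferentiableAt.comp (g := Complex.sqrt) (f := fun x : ℂ => 1 - k ^ 2 * x ^ 2) x
        (Complex.differentiableAt_sqrt h2) (by fun_prop)
    refine (DifferentiableAt.div (differentiableAt_const (1 : ℂ)) (a1.mul a2)
      ?_).differentiableWithinAt
    exact mul_ne_zero (sqrt_ne_zero_of_slit h1) (sqrt_ne_zero_of_slit h2)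
  obtain ⟨G, hG0, hG⟩ := hd.isExactOn_ball.with_val_at 0 0
  have hEq : ∀ x ∈ Metric.ball (0 : ℂ) R, ellipticF k x = G x := by
    intro x hx
    have hmem : ∀ t ∈ uIcc (0 : ℝ) 1, (t : ℂ) * x ∈ Metric.ball (0 : ℂ) R := by
      intro t ht
      rw [uIcc_of_le zero_le_one] at ht
      simp only [mem_ball_zero_iff, norm_mul, Complex.norm_real, Real.norm_eq_abs,
        abs_of_nonneg ht.1] at hx ⊢
      nlinarith [norm_nonneg x, ht.2]
    have hder : ∀ t ∈ uIcc (0 : ℝ) 1, HasDerivAt (fun t : ℝ => G (t * x))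
        (x * ellipticIntegrand k (t * x)) t := by
      intro t ht
      have h1 : HasDerivAt (fun t : ℝ => (t : ℂ) * x) x t := by
        simpa using (Complex.ofRealCLM.hasDerivAt (x := t)).mul_const x
      have := (hG _ (hmem t ht)).comp t h1
      rwa [mul_comm] at this
    have hc : ContinuousOn (fun t : ℝ => x * ellipticIntegrand k (t * x)) (uIcc 0 1) := by
      refine continuousOn_const.mul (hd.continuousOn.comp (by fun_prop) hmem)
    have := intervalIntegral.integral_eq_sub_of_hasDerivAt hder hc.intervalIntegrable
    simpa [ellipticF, hG0] using this
  filter_upwards [Metric.ball_mem_nhds (0 : ℂ) hR] with x hx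
  refine (hG x hx).congr_of_eventuallyEq ?_
  filter_upwards [Metric.isOpen_ball.mem_nhds hx] with y hy using hEq y hy

lemma ellipticF_zero (k : ℂ) : ellipticF k 0 = 0 := by simp [ellipticF]

/-- The germs at `0` of the Jacobi elliptic functions. -/
lemma exists_germ (k : ℂ) : ∃ s c d : ℂ → ℂ,
    AnalyticAt ℂ s 0 ∧ AnalyticAt ℂ c 0 ∧ AnalyticAt ℂ d 0 ∧ s 0 = 0 ∧ c 0 = 1 ∧ d 0 = 1 ∧
    (∀ᶠ x in 𝓝 (0 : ℂ), s (ellipticF k x) = x) ∧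
    (∀ᶠ u in 𝓝 (0 : ℂ), c u = Complex.sqrt (1 - s u ^ 2)) ∧
    (∀ᶠ u in 𝓝 (0 : ℂ), d u = Complex.sqrt (1 - k ^ 2 * s u ^ 2)) ∧
    (∀ᶠ u in 𝓝 (0 : ℂ), HasDerivAt s (c u * d u) u) ∧
    (∀ᶠ u in 𝓝 (0 : ℂ), ellipticF k (s u) = u) := by
  have hF := hasDerivAt_ellipticF k
  have hFa : AnalyticAt ℂ (ellipticF k) 0 := by
    rw [Complex.analyticAt_iff_eventually_differentiableAt]
    exact hF.mono fun x hx => hx.differentiableAt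
  have hF' : deriv (ellipticF k) 0 ≠ 0 := by
    rw [hF.self_of_nhds.deriv]
    simp [ellipticIntegrand]
  set s := hFa.hasStrictDerivAt.localInverse _ _ _ hF' with hs
  have hsa : AnalyticAt ℂ s 0 := by
    have := hFa.analyticAt_localInverse hF'
    rwa [ellipticF_zero] at this
  have hleft : ∀ᶠ x in 𝓝 (0 : ℂ), s (ellipticF k x) = x :=
    hFa.hasStrictDerivAt.eventually_left_inverse hF'
  have hright : ∀ᶠ u in 𝓝 (0 : ℂ), ellipticF k (s u) = u := by
    have := hFa.hasStrictDerivAt.eventually_right_inverse hF'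
    rwa [ellipticF_zero] at this
  have hs0 : s 0 = 0 := by
    have := hleft.self_of_nhds
    rwa [ellipticF_zero] at this
  have hst : Tendsto s (𝓝 0) (𝓝 0) := by
    have := hsa.continuousAt.tendsto
    rwa [hs0] at this
  have root_analytic : ∀ m : ℂ, AnalyticAt ℂ (fun u => Complex.sqrt (1 - m * s u ^ 2)) 0 := by
    intro m
    exact AnalyticAt.fun_comp (f := fun u => 1 - m * s u ^ 2)
      (sqrt_analyticAt (z := 1 - m * s 0 ^ 2) (by simp [hs0])) (by fun_prop)
  refine ⟨s, fun u => Complex.sqrt (1 - s u ^ 2), fun u => Complex.sqrt (1 - k ^ 2 * s u ^ 2),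
    hsa, by simpa using root_analytic 1, root_analytic _, hs0, by simp [hs0],
    by simp [hs0], hleft, Eventually.of_forall fun _ => rfl,
    Eventually.of_forall fun _ => rfl, ?_, hright⟩
  filter_upwards [hst.eventually hF, hsa.eventually_analyticAt, hright.eventually_nhds,
    hst.eventually (slit_nhds 1), hst.eventually (slit_nhds (k ^ 2))] with u h1 h2 h3 h4 h5
  have h6 : HasDerivAt (fun v => ellipticF k (s v)) (ellipticIntegrand k (s u) * deriv s u) u :=
    h1.comp u h2.differentiableAt.hasDerivAt
  have h7 : HasDerivAt (fun v => ellipticF k (s v)) 1 u :=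
    (hasDerivAt_id u).congr_of_eventuallyEq h3
  have h8 := h6.unique h7
  rw [one_mul] at h4
  have e1 : Complex.sqrt (1 - s u ^ 2) ≠ 0 := sqrt_ne_zero_of_slit h4
  have e2 : Complex.sqrt (1 - k ^ 2 * s u ^ 2) ≠ 0 := sqrt_ne_zero_of_slit h5
  have h9 : deriv s u = Complex.sqrt (1 - s u ^ 2) * Complex.sqrt (1 - k ^ 2 * s u ^ 2) := by
    rw [ellipticIntegrand, one_div, inv_mul_eq_one₀ (mul_ne_zero e1 e2)] at h8
    exact h8.symm
  rw [← h9]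
  exact h2.differentiableAt.hasDerivAt

/-- Identity theorem for meromorphic functions in normal form. -/
lemma eqOn_of_germ {f g : ℂ → ℂ} {U : Set ℂ} (hU : IsPreconnected U) (h0 : (0 : ℂ) ∈ U)
    (hf : MeromorphicNFOn f U) (hg : MeromorphicNFOn g U) (h : f =ᶠ[𝓝 0] g) : EqOn f g U := by
  intro x hx
  have hm : MeromorphicOn (f - g) U := hf.meromorphicOn.sub hg.meromorphicOn
  have htop0 : meromorphicOrderAt (f - g) 0 = ⊤ := by
    rw [meromorphicOrderAt_eq_top_iff]
    refine Filter.Eventually.filter_mono nhdsWithin_le_nhds ?_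
    filter_upwards [h] with y hy
    simp [hy]
  have htop : meromorphicOrderAt (f - g) x = ⊤ := by
    by_contra hne
    exact hm.meromorphicOrderAt_ne_top_of_isPreconnected hU hx h0 hne htop0
  rw [meromorphicOrderAt_eq_top_iff] at htop
  have : f =ᶠ[𝓝[≠] x] g := by
    filter_upwards [htop] with y hy
    exact sub_eq_zero.1 hy
  exact (((hf hx).eventuallyEq_nhdsNE_iff_eventuallyEq_nhds (hg hx)).1 this).eq_of_nhds

/-- Duplication formulas for the germs. -/
lemma germ_duplication {k : ℂ} {s c d : ℂ → ℂ}
    (hs : AnalyticAt ℂ s 0) (hc : AnalyticAt ℂ c 0) (hd : AnalyticAt ℂ d 0)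
    (hs0 : s 0 = 0) (hc0 : c 0 = 1) (hd0 : d 0 = 1)
    (hF : ∀ᶠ x in 𝓝 (0 : ℂ), s (ellipticF k x) = x)
    (hcs : ∀ᶠ u in 𝓝 (0 : ℂ), c u = Complex.sqrt (1 - s u ^ 2))
    (hds : ∀ᶠ u in 𝓝 (0 : ℂ), d u = Complex.sqrt (1 - k ^ 2 * s u ^ 2))
    (hder : ∀ᶠ u in 𝓝 (0 : ℂ), HasDerivAt s (c u * d u) u) :
    ∀ᶠ u in 𝓝 (0 : ℂ),
      2 * s (u / 2) * c (u / 2) * d (u / 2) / (1 - k ^ 2 * s (u / 2) ^ 4) = s u ∧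
      (1 - 2 * s (u / 2) ^ 2 + k ^ 2 * s (u / 2) ^ 4) / (1 - k ^ 2 * s (u / 2) ^ 4) = c u ∧
      (1 - 2 * k ^ 2 * s (u / 2) ^ 2 + k ^ 2 * s (u / 2) ^ 4) / (1 - k ^ 2 * s (u / 2) ^ 4)
        = d u := by
  set S : ℂ → ℂ := fun u => 2 * s u * c u * d u / (1 - k ^ 2 * s u ^ 4) with hS
  set C : ℂ → ℂ := fun u => (1 - 2 * s u ^ 2 + k ^ 2 * s u ^ 4) / (1 - k ^ 2 * s u ^ 4) with hC
  set D : ℂ → ℂ :=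
    fun u => (1 - 2 * k ^ 2 * s u ^ 2 + k ^ 2 * s u ^ 4) / (1 - k ^ 2 * s u ^ 4) with hD
  have n0 : 1 - k ^ 2 * s 0 ^ 4 ≠ 0 := by simp [hs0]
  have hSa : AnalyticAt ℂ S 0 := by fun_prop (disch := exact n0)
  have hCa : AnalyticAt ℂ C 0 := by fun_prop (disch := exact n0)
  have hDa : AnalyticAt ℂ D 0 := by fun_prop (disch := exact n0)
  have hSt : Tendsto S (𝓝 0) (𝓝 0) := by simpa [hS, hs0] using hSa.continuousAt.tendsto
  have hCt : Tendsto C (𝓝 0) (𝓝 1) := by simpa [hC, hs0] using hCa.continuousAt.tendsto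
  have hDt : Tendsto D (𝓝 0) (𝓝 1) := by simpa [hD, hs0] using hDa.continuousAt.tendsto
  have hre : ∀ᶠ w in 𝓝 (1 : ℂ), 0 < w.re :=
    (Complex.continuous_re.tendsto 1).eventually (lt_mem_nhds (by simp))
  have hN : ∀ᶠ u in 𝓝 (0 : ℂ), 1 - k ^ 2 * s u ^ 4 ≠ 0 :=
    (show ContinuousAt (fun u => 1 - k ^ 2 * s u ^ 4) 0 by
      have := hs.continuousAt; fun_prop).eventually_ne n0
  -- the square roots
  have hCS : ∀ᶠ u in 𝓝 (0 : ℂ), Complex.sqrt (1 - S u ^ 2) = C u := by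
    filter_upwards [hCt.eventually hre, hN, hcs, hds] with u h1 h2 h3 h4
    have h3' : c u ^ 2 = 1 - s u ^ 2 := by rw [h3, sqrt_mul_self']
    have h4' : d u ^ 2 = 1 - k ^ 2 * s u ^ 2 := by rw [h4, sqrt_mul_self']
    rw [← sqrt_sq_of_re_pos h1]
    congr 1
    simp only [hS, hC]
    obtain ⟨N, hNe⟩ : ∃ N, N = 1 - k ^ 2 * s u ^ 4 := ⟨_, rfl⟩
    rw [← hNe] at h2 ⊢
    field_simp
    rw [h3', h4', hNe]
    ring
  have hDS : ∀ᶠ u in 𝓝 (0 : ℂ), Complex.sqrt (1 - k ^ 2 * S u ^ 2) = D u := by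
    filter_upwards [hDt.eventually hre, hN, hcs, hds] with u h1 h2 h3 h4
    have h3' : c u ^ 2 = 1 - s u ^ 2 := by rw [h3, sqrt_mul_self']
    have h4' : d u ^ 2 = 1 - k ^ 2 * s u ^ 2 := by rw [h4, sqrt_mul_self']
    rw [← sqrt_sq_of_re_pos h1]
    congr 1
    simp only [hS, hD]
    obtain ⟨N, hNe⟩ : ∃ N, N = 1 - k ^ 2 * s u ^ 4 := ⟨_, rfl⟩
    rw [← hNe] at h2 ⊢
    field_simp
    rw [h3', h4', hNe]
    ring
  have hSder : ∀ᶠ u in 𝓝 (0 : ℂ), HasDerivAt S (2 * (C u * D u)) u := by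
    have hct : Tendsto c (𝓝 0) (𝓝 1) := by simpa [hc0] using hc.continuousAt.tendsto
    have hdt : Tendsto d (𝓝 0) (𝓝 1) := by simpa [hd0] using hd.continuousAt.tendsto
    filter_upwards [hN, hcs.eventually_nhds, hds.eventually_nhds, hder,
      hc.eventually_analyticAt, hd.eventually_analyticAt, hct.eventually hre,
      hdt.eventually hre] with u h2 h3 h4 h5 h6 h7 h8 h9
    have c0 : c u ≠ 0 := by rintro h; simp [h] at h8
    have d0 : d u ≠ 0 := by rintro h; simp [h] at h9
    have e3 : (fun v => c v ^ 2) =ᶠ[𝓝 u] fun v => 1 - s v ^ 2 := by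
      filter_upwards [h3] with v hv
      rw [hv, sqrt_mul_self']
    have e4 : (fun v => d v ^ 2) =ᶠ[𝓝 u] fun v => 1 - k ^ 2 * s v ^ 2 := by
      filter_upwards [h4] with v hv
      rw [hv, sqrt_mul_self']
    have dc : HasDerivAt c (-(s u * d u)) u := by
      have a := h6.differentiableAt.hasDerivAt
      have b := (a.pow 2).unique
        (((h5.pow 2).const_sub 1).congr_of_eventuallyEq e3)
      have : deriv c u = -(s u * d u) := by
        apply mul_left_cancel₀ c0
        push_cast at b
        linear_combination b / 2
      rwa [this] at a
    have dd : HasDerivAt d (-(k ^ 2 * s u * c u)) u := by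
      have a := h7.differentiableAt.hasDerivAt
      have b := (a.pow 2).unique
        ((((h5.pow 2).const_mul (k ^ 2)).const_sub 1).congr_of_eventuallyEq e4)
      have : deriv d u = -(k ^ 2 * s u * c u) := by
        apply mul_left_cancel₀ d0
        push_cast at b
        linear_combination b / 2
      rwa [this] at a
    have h3' : c u ^ 2 = 1 - s u ^ 2 := e3.eq_of_nhds
    have h4' : d u ^ 2 = 1 - k ^ 2 * s u ^ 2 := e4.eq_of_nhds
    have key := (((h5.const_mul 2).mul dc).mul dd).div
      (((h5.pow 4).const_mul (k ^ 2)).const_sub 1) h2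
    refine key.congr_deriv ?_
    simp only [hC, hD, Pi.mul_apply, Pi.pow_apply]
    have hcd : c u ^ 2 * d u ^ 2 = (1 - s u ^ 2) * (1 - k ^ 2 * s u ^ 2) := by rw [h3', h4']
    rw [div_mul_div_comm, ← mul_div_assoc, ← sq]
    congr 1
    push_cast
    linear_combination (2 * (1 - k ^ 2 * s u ^ 4) + 8 * k ^ 2 * s u ^ 4) * hcd
      - 2 * s u ^ 2 * (1 - k ^ 2 * s u ^ 4) * h4'
      - 2 * k ^ 2 * s u ^ 2 * (1 - k ^ 2 * s u ^ 4) * h3'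
  -- integrate
  have hT : Tendsto (fun u : ℂ => u / 2) (𝓝 0) (𝓝 0) := by
    have : ContinuousAt (fun u : ℂ => u / 2) 0 := by fun_prop
    simpa using this.tendsto
  have hone : ∀ᶠ u in 𝓝 (0 : ℂ), HasDerivAt (fun v => ellipticF k (S (v / 2))) 1 u := by
    filter_upwards [hT.eventually hSder, hT.eventually hCS, hT.eventually hDS,
      (hSt.comp hT).eventually (hasDerivAt_ellipticF k),
      hT.eventually (hCt.eventually hre), hT.eventually (hDt.eventually hre)] with
      u h1 h2 h3 h4 h5 h6
    have c0 : C (u / 2) ≠ 0 := by rintro h; simp [h] at h5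
    have d0 : D (u / 2) ≠ 0 := by rintro h; simp [h] at h6
    have a : HasDerivAt (fun v : ℂ => v / 2) (1 / 2) u := (hasDerivAt_id u).div_const 2
    have b := (HasDerivAt.comp u h4 (h1.comp u a))
    refine b.congr_deriv ?_
    simp only [Function.comp, ellipticIntegrand, h2, h3]
    field_simp
  have hid : ∀ᶠ u in 𝓝 (0 : ℂ), ellipticF k (S (u / 2)) = u := by
    obtain ⟨R, hR, hb⟩ := Metric.eventually_nhds_iff_ball.1 hone
    filter_upwards [Metric.ball_mem_nhds (0 : ℂ) hR] with u hu
    have hcst := (convex_ball (0 : ℂ) R).is_const_of_fderivWithin_eq_zero (𝕜 := ℂ)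
      (f := fun v => ellipticF k (S (v / 2)) - v)
      (fun v hv => ((hb v hv).sub (hasDerivAt_id v)).differentiableAt.differentiableWithinAt)
      (fun v hv => by
        have h := ((hb v hv).sub (hasDerivAt_id v))
        rw [sub_self] at h
        have h' := h.hasFDerivAt.hasFDerivWithinAt (s := Metric.ball (0 : ℂ) R)
        have := h'.fderivWithin (Metric.isOpen_ball.uniqueDiffWithinAt hv)
        refine Eq.trans this ?_
        ext; simp)
      hu (Metric.mem_ball_self hR)
    have : S (0 / 2) = 0 := by simp [hS, hs0]
    simp only [this, ellipticF_zero, sub_zero] at hcst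
    exact sub_eq_zero.1 hcst
  have hSs : ∀ᶠ u in 𝓝 (0 : ℂ), S (u / 2) = s u := by
    filter_upwards [hid, (hSt.comp hT).eventually hF] with u h1 h2
    simp only [Function.comp, h1] at h2
    exact h2.symm
  filter_upwards [hSs, hcs, hds, hT.eventually hCS, hT.eventually hDS] with u h1 h2 h3 h4 h5
  refine ⟨h1, ?_, ?_⟩
  · rw [h2, ← h1, h4]
  · rw [h3, ← h1, h5]

/-- For every complex modulus the Jacobi elliptic functions exist and are unique: the germs are
continued to the whole plane by the duplication formulas. -/
theorem existsUnique_isJacobiTriple (k : ℂ) :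
    ∃! f : (ℂ → ℂ) × (ℂ → ℂ) × (ℂ → ℂ), IsJacobiTriple k f.1 f.2.1 f.2.2 := by
  obtain ⟨s, c, d, hs, hc, hd, hs0, hc0, hd0, hF, hcs, hds, hder, hright⟩ := exists_germ k
  have hdup := germ_duplication hs hc hd hs0 hc0 hd0 hF hcs hds hder
  obtain ⟨r, hr, hr'⟩ := Metric.eventually_nhds_iff_ball.1
    (hs.eventually_analyticAt.and (hc.eventually_analyticAt.and hd.eventually_analyticAt))
  have mdup2 : ∀ (F G H : ℂ → ℂ) (x : ℂ), MeromorphicAt F x → MeromorphicAt G x →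
      MeromorphicAt H x →
      MeromorphicAt (fun u => 2 * F u * G u * H u / (1 - k ^ 2 * F u ^ 4)) x := by
    intro F G H x hF hG hH
    fun_prop
  have mdup1 : ∀ (m : ℂ) (F : ℂ → ℂ) (x : ℂ), MeromorphicAt F x →
      MeromorphicAt (fun u => (1 - m * F u ^ 2 + k ^ 2 * F u ^ 4) / (1 - k ^ 2 * F u ^ 4)) x := by
    intro m F x hF
    fun_prop
  -- normal forms of meromorphic continuations
  have norm : ∀ (f g : ℂ → ℂ) (U : Set ℂ), (0 : ℂ) ∈ U → MeromorphicOn f U →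
      AnalyticAt ℂ g 0 → f =ᶠ[𝓝 0] g →
      MeromorphicNFOn (toMeromorphicNFOn f U) U ∧ toMeromorphicNFOn f U =ᶠ[𝓝 0] g := by
    intro f g U h0 hf hg hfg
    refine ⟨meromorphicNFOn_toMeromorphicNFOn f U, ?_⟩
    rw [← MeromorphicNFAt.eventuallyEq_nhdsNE_iff_eventuallyEq_nhds
      (meromorphicNFOn_toMeromorphicNFOn f U h0) hg.meromorphicNFAt]
    exact (hf.toMeromorphicNFOn_eq_self_on_nhdsNE h0).trans
      (hfg.filter_mono nhdsWithin_le_nhds)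
  have hex : ∀ n : ℕ, ∃ f : (ℂ → ℂ) × (ℂ → ℂ) × (ℂ → ℂ),
      (MeromorphicNFOn f.1 (Metric.ball 0 (2 ^ n * r)) ∧ f.1 =ᶠ[𝓝 0] s) ∧
      (MeromorphicNFOn f.2.1 (Metric.ball 0 (2 ^ n * r)) ∧ f.2.1 =ᶠ[𝓝 0] c) ∧
      (MeromorphicNFOn f.2.2 (Metric.ball 0 (2 ^ n * r)) ∧ f.2.2 =ᶠ[𝓝 0] d) := by
    intro n
    induction n with
    | zero =>
      refine ⟨(s, c, d), ⟨fun x hx => ?_, .rfl⟩, ⟨fun x hx => ?_, .rfl⟩, ⟨fun x hx => ?_, .rfl⟩⟩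
      all_goals
        rw [pow_zero, one_mul] at hx
        obtain ⟨h1, h2, h3⟩ := hr' x hx
        apply AnalyticAt.meromorphicNFAt
        assumption
    | succ n ih =>
      obtain ⟨⟨f, g, h⟩, ⟨hf, hfs⟩, ⟨hg, hgc⟩, ⟨hh, hhd⟩⟩ := ih
      simp only at hf hfs hg hgc hh hhd
      have hmem : ∀ x ∈ Metric.ball (0 : ℂ) (2 ^ (n + 1) * r),
          x / 2 ∈ Metric.ball (0 : ℂ) (2 ^ n * r) := by
        intro x hx
        rw [mem_ball_zero_iff] at hx ⊢
        rw [norm_div, Complex.norm_ofNat]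
        rw [pow_succ] at hx
        linarith
      have half : ∀ φ : ℂ → ℂ, MeromorphicNFOn φ (Metric.ball 0 (2 ^ n * r)) →
          MeromorphicOn (fun u => φ (u / 2)) (Metric.ball 0 (2 ^ (n + 1) * r)) := by
        intro φ hφ x hx
        exact (hφ (hmem x hx)).meromorphicAt.comp_analyticAt (g := fun u : ℂ => u / 2)
          (by fun_prop)
      have mf := half f hf
      have mg := half g hg
      have mh := half h hh
      have h0 : (0 : ℂ) ∈ Metric.ball (0 : ℂ) (2 ^ (n + 1) * r) :=
        Metric.mem_ball_self (by positivity)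
      have hT : Tendsto (fun u : ℂ => u / 2) (𝓝 0) (𝓝 0) := by
        have : ContinuousAt (fun u : ℂ => u / 2) 0 := by fun_prop
        simpa using this.tendsto
      have e1 := hT.eventually hfs
      have e2 := hT.eventually hgc
      have e3 := hT.eventually hhd
      refine ⟨(toMeromorphicNFOn (fun u => 2 * f (u / 2) * g (u / 2) * h (u / 2) /
          (1 - k ^ 2 * f (u / 2) ^ 4)) (Metric.ball 0 (2 ^ (n + 1) * r)),
        toMeromorphicNFOn (fun u => (1 - 2 * f (u / 2) ^ 2 + k ^ 2 * f (u / 2) ^ 4) /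
          (1 - k ^ 2 * f (u / 2) ^ 4)) (Metric.ball 0 (2 ^ (n + 1) * r)),
        toMeromorphicNFOn (fun u => (1 - 2 * k ^ 2 * f (u / 2) ^ 2 + k ^ 2 * f (u / 2) ^ 4) /
          (1 - k ^ 2 * f (u / 2) ^ 4)) (Metric.ball 0 (2 ^ (n + 1) * r))),
        norm _ s _ h0 ?_ hs ?_, norm _ c _ h0 ?_ hc ?_, norm _ d _ h0 ?_ hd ?_⟩
      · intro x hx
        exact mdup2 _ _ _ x (mf x hx) (mg x hx) (mh x hx)
      · filter_upwards [e1, e2, e3, hdup] with u h1 h2 h3 h4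
        rw [h1, h2, h3, h4.1]
      · intro x hx
        exact mdup1 _ _ x (mf x hx)
      · filter_upwards [e1, hdup] with u h1 h4
        rw [h1, h4.2.1]
      · intro x hx
        exact mdup1 _ _ x (mf x hx)
      · filter_upwards [e1, hdup] with u h1 h4
        rw [h1, h4.2.2]
  -- glue
  have glue : ∀ (p : ℂ → ℂ) (f : ℕ → ℂ → ℂ),
      (∀ n, MeromorphicNFOn (f n) (Metric.ball 0 (2 ^ n * r)) ∧ f n =ᶠ[𝓝 0] p) →
      ∃ g : ℂ → ℂ, MeromorphicNFOn g univ ∧ g =ᶠ[𝓝 0] p := by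
    intro p f hf
    have hN : ∀ x : ℂ, ∃ n : ℕ, x ∈ Metric.ball (0 : ℂ) (2 ^ n * r) := by
      intro x
      obtain ⟨n, hn⟩ := pow_unbounded_of_one_lt (‖x‖ / r) (one_lt_two)
      exact ⟨n, by rw [mem_ball_zero_iff]; exact (div_lt_iff₀ hr).1 hn⟩
    choose N hN using hN
    have hmono : ∀ {m n : ℕ}, m ≤ n →
        Metric.ball (0 : ℂ) (2 ^ m * r) ⊆ Metric.ball 0 (2 ^ n * r) := by
      intro m n hmn
      apply Metric.ball_subset_ball
      gcongr
      norm_num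
    have hle : ∀ {m n : ℕ}, m ≤ n → EqOn (f m) (f n) (Metric.ball 0 (2 ^ m * r)) := by
      intro m n hmn
      exact eqOn_of_germ (convex_ball _ _).isPreconnected (Metric.mem_ball_self (by positivity))
        (hf m).1 (fun x hx => (hf n).1 (hmono hmn hx)) ((hf m).2.trans (hf n).2.symm)
    have hall : ∀ n, ∀ x ∈ Metric.ball (0 : ℂ) (2 ^ n * r), f (N x) x = f n x := by
      intro n x hx
      rcases le_total (N x) n with h | h
      · exact hle h (hN x)
      · exact (hle h hx).symm
    have hloc : ∀ n, ∀ x ∈ Metric.ball (0 : ℂ) (2 ^ n * r),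
        (fun y => f (N y) y) =ᶠ[𝓝 x] f n := by
      intro n x hx
      filter_upwards [Metric.isOpen_ball.mem_nhds hx] with y hy using hall n y hy
    refine ⟨fun x => f (N x) x, fun x _ => ?_, ?_⟩
    · rw [meromorphicNFAt_congr (hloc _ x (hN x))]
      exact (hf _).1 (hN x)
    · exact (hloc _ 0 (hN 0)).trans (hf _).2
  choose f hf using hex
  obtain ⟨s', ms, es⟩ := glue s (fun n => (f n).1) (fun n => (hf n).1)
  obtain ⟨c', mc, ec⟩ := glue c (fun n => (f n).2.1) (fun n => (hf n).2.1)
  obtain ⟨d', md, ed⟩ := glue d (fun n => (f n).2.2) (fun n => (hf n).2.2)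
  refine ⟨(s', c', d'), ⟨ms, mc, md, ?_, ?_, ?_⟩, ?_⟩
  · have hc : Tendsto (ellipticF k) (𝓝 0) (𝓝 0) := by
      have := (hasDerivAt_ellipticF k).self_of_nhds.continuousAt.tendsto
      rwa [ellipticF_zero] at this
    filter_upwards [hF, hc.eventually es] with x h1 h2
    exact h2.trans h1
  · filter_upwards [hcs, es, ec] with u h1 h2 h3
    simp only [h2, h3, h1]
  · filter_upwards [hds, es, ed] with u h1 h2 h3
    simp only [h2, h3, h1]
  · rintro ⟨s₂, c₂, d₂⟩ h
    have hst : Tendsto s (𝓝 0) (𝓝 0) := by simpa [hs0] using hs.continuousAt.tendsto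
    have es₂ : s₂ =ᶠ[𝓝 0] s := by
      filter_upwards [hst.eventually h.sn_ellipticF, hright] with u h1 h2
      rwa [h2] at h1
    have ec₂ : c₂ =ᶠ[𝓝 0] c := by
      filter_upwards [h.cn_eq, es₂, hcs] with u h1 h2 h3
      rw [h1, h3, ← h2]
    have ed₂ : d₂ =ᶠ[𝓝 0] d := by
      filter_upwards [h.dn_eq, es₂, hds] with u h1 h2 h3
      rw [h1, h3, ← h2]
    have eq : ∀ {f g p : ℂ → ℂ}, MeromorphicNFOn f univ → MeromorphicNFOn g univ →
        f =ᶠ[𝓝 0] p → g =ᶠ[𝓝 0] p → f = g := fun hf hg h1 h2 =>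
      funext fun x => eqOn_of_germ isPreconnected_univ (mem_univ _) hf hg (h1.trans h2.symm)
        (mem_univ x)
    exact Prod.ext (eq h.meromorphic_sn ms es₂ es) (Prod.ext (eq h.meromorphic_cn mc ec₂ ec)
      (eq h.meromorphic_dn md ed₂ ed))

/-- The Jacobi elliptic function `sn(·, k)` of modulus `k`. -/
def sn (k : ℂ) : ℂ → ℂ := (existsUnique_isJacobiTriple k).choose.1

/-- The Jacobi elliptic function `cn(·, k)` of modulus `k`. -/
def cn (k : ℂ) : ℂ → ℂ := (existsUnique_isJacobiTriple k).choose.2.1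

/-- The Jacobi elliptic function `dn(·, k)` of modulus `k`. -/
def dn (k : ℂ) : ℂ → ℂ := (existsUnique_isJacobiTriple k).choose.2.2

/-- The chosen functions are the Jacobi elliptic functions. -/
theorem isJacobiTriple (k : ℂ) : IsJacobiTriple k (sn k) (cn k) (dn k) :=
  (existsUnique_isJacobiTriple k).choose_spec.1

end

end JacobiElliptic

namespace KNdS

noncomputable section

/-! ### The two forms of Heun's equation -/

/-- Heun's equation
`y'' + (γ/z + δ/(z-1) + ε/(z-A)) y' + (αβz - q)/(z(z-1)(z-A)) y = 0` for `y` at the point `z`. -/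
def HeunEquationAt (A q α β γ δ ε : ℂ) (y : ℂ → ℂ) (z : ℂ) : Prop :=
  deriv (deriv y) z + (γ / z + δ / (z - 1) + ε / (z - A)) * deriv y z
    + (α * β * z - q) / (z * (z - 1) * (z - A)) * y z = 0

/-- The Jacobian elliptic (Darboux) form, for exponents `μ₁, μ₂, μ₃`, for `Y` at the point `u`. -/
def JacobiFormAt (k q α β μ₁ μ₂ μ₃ : ℂ) (Y : ℂ → ℂ) (u : ℂ) : Prop :=
  open JacobiElliptic in
  deriv (deriv Y) u
    + ((4 * μ₁ + 1) * (cn k u * dn k u / sn k u)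
        - (4 * μ₂ + 1) * (sn k u * dn k u / cn k u)
        - k ^ 2 * (4 * μ₃ + 1) * (sn k u * cn k u / dn k u)) * deriv Y u
    + (4 * α * β * k ^ 2 * sn k u ^ 2 - 4 * k ^ 2 * q) * Y u = 0

/-! ### Kerr-Newman-de Sitter quantities

`Λ` is the cosmological constant, `a` the Kerr parameter, `M` and `e` the mass and the electric
charge of the black hole, `qs` the charge of the scalar particle, `ω` and `m` its frequency and
azimuthal number, and `Klm` the separation constant. -/

/-- `α_Λ = a² Λ / 3` -/
def alphaL (Λ a : ℝ) : ℝ := a ^ 2 * Λ / 3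

/-- `Ξ = 1 + a² Λ / 3` -/
def Xi (Λ a : ℝ) : ℝ := 1 + a ^ 2 * Λ / 3

/-- The radial function `Δ_r` of the Kerr-Newman-de Sitter metric. -/
def DeltaR (Λ a M e r : ℝ) : ℝ :=
  (1 - Λ / 3 * r ^ 2) * (r ^ 2 + a ^ 2) - 2 * M * r + e ^ 2

/-- `K(r) = ω (r² + a²) - a m` -/
def radialK (a : ℝ) (ω : ℂ) (m : ℤ) (r : ℝ) : ℂ := ω * (r ^ 2 + a ^ 2) - a * m

/-- The third finite singularity `z_r` of the radial Heun equation. -/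
def radialZr (rm rp rLm rLp : ℝ) : ℝ :=
  (rp - rLm) / (rp - rm) * ((rLp - rm) / (rLp - rLm))

/-- The exponent at a horizon `r₀`, up to sign, where `r₁, r₂, r₃` are the other three roots of
`Δ_r`; the factor `3 / Λ` is `a² / α_Λ`. -/
def radialExponent (Λ a e qs : ℝ) (ω : ℂ) (m : ℤ) (r₀ r₁ r₂ r₃ : ℝ) : ℂ :=
  Complex.I * (3 / Λ) * (Xi Λ a * radialK a ω m r₀ - e * qs * r₀)
    / ((r₁ - r₀) * (r₂ - r₀) * (r₃ - r₀))

/-- The third finite singularity `z_3` of the angular Heun equation. -/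
def angularZ3 (Λ a : ℝ) : ℂ :=
  -(1 / 2) * (-1 + (alphaL Λ a - 1) / (2 * Complex.I * √(alphaL Λ a)))

/-- `|m| / 2`, the exponent of the angular equation at `z = 0` and at `z = 1`. -/
def angularExponent₁ (m : ℤ) : ℂ := |(m : ℝ)| / 2

/-- The exponent of the angular equation at `z = z_3`, up to sign. -/
def angularExponent₃ (Λ a : ℝ) (ω : ℂ) (m : ℤ) : ℂ :=
  Complex.I / 2 * (Xi Λ a * (a * ω) / √(alphaL Λ a) - m * √(alphaL Λ a))

/-- The accessory parameter `q` of the angular Heun equation with exponents `α₁, α₂, α₃`. -/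
def angularQ (Λ a : ℝ) (ω : ℂ) (m : ℤ) (Klm α₁ α₂ α₃ : ℂ) : ℂ :=
  let s : ℂ := √(alphaL Λ a)
  Complex.I / (4 * s) *
    (-(1 + Complex.I * s) ^ 2 * (2 * α₁ * α₂ + α₂ + α₁)
      - 4 * s * Complex.I * (2 * α₁ * α₃ + α₃ + α₁)
      - m ^ 2 / 2 * ((1 + Complex.I * s) ^ 2 + 4 * alphaL Λ a)
      + Klm - 2 * Complex.I * s + 2 * Xi Λ a * m * (a * ω))

/-- The product `αβ` of the angular Heun equation with exponents `α₁, α₂, α₃`. -/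
def angularAlphaBeta (Λ a : ℝ) (ω : ℂ) (m : ℤ) (Klm α₁ α₂ α₃ : ℂ) : ℂ :=
  let s : ℂ := √(alphaL Λ a)
  angularQ Λ a ω m Klm α₁ α₂ α₃
    + Complex.I / (4 * s) *
      (m ^ 2 / 2 * ((1 - Complex.I * s) ^ 2 + 4 * alphaL Λ a)
        - 2 * m * (a * ω) * Xi Λ a - Klm - 2 * s * Complex.I
        + (1 - Complex.I * s) ^ 2 * (2 * α₁ * α₂ + α₂ + α₁)
        + Complex.I * 4 * s * (-2 * α₂ * α₃ - α₃ - α₂))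

end

end KNdS

/-! ### Algebraic and differential identities for `sn`, `cn`, `dn`, continued from the origin. -/

namespace JacobiElliptic

open Filter Topology Set

/-! The equivalence is the chain rule for z = sn². From z' = 2 sn cn dn one gets z''/z' = cn dn/sn -
sn dn/cn - k² sn cn/dn, and with A = k⁻² the factors of Heun's equation become z - 1 = -cn² and z -
A = -dn²/k². Since Y' = y' z' and Y'' = y'' z'² + y' z'', multiplying Heun's equation by z'² gives
(J): the coefficient of Y' in the first bracket is 2(2ν₁ + 1) - 1 = 4ν₁ + 1, likewise for the other
two, and z'²/(z(z - 1)(z - A)) = 4k². As z' ≠ 0, the multiplication is reversible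
(`heunEquationAt_iff_jacobiFormAt`).

The analytic content is that cn² = 1 - sn², dn² = 1 - k² sn² and sn' = cn dn hold at u, although the
functions are characterised only by germs at 0. The identities are read off near 0 and carried to u
by the identity theorem for meromorphic functions (`eventuallyEq_of_germ`, `jacobi_identities`);
poles between 0 and u are no obstacle.

The radial and angular cases are instances with A = z_*. What remains for each is z_* ≠ 0, which
makes k a genuine nonzero modulus. -/

/-- Two meromorphic functions on `ℂ` with the same germ at `0` have the same germ at every point
where both are analytic. -/
lemma eventuallyEq_of_germ {f g : ℂ → ℂ} {u : ℂ}
    (hf : MeromorphicOn f univ) (hg : MeromorphicOn g univ) (h : f =ᶠ[𝓝 0] g)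
    (hfu : AnalyticAt ℂ f u) (hgu : AnalyticAt ℂ g u) : f =ᶠ[𝓝 u] g := by
  have hm : MeromorphicOn (f - g) univ := hf.sub hg
  have h0 : meromorphicOrderAt (f - g) 0 = ⊤ := by
    rw [meromorphicOrderAt_eq_top_iff]
    refine Filter.Eventually.filter_mono nhdsWithin_le_nhds ?_
    filter_upwards [h] with y hy
    simp [hy]
  -- Order `⊤` means vanishing on a punctured neighbourhood; on a connected set this holds
  -- everywhere or nowhere.
  have hu : meromorphicOrderAt (f - g) u = ⊤ := by
    by_contra hne
    exact hm.meromorphicOrderAt_ne_top_of_isPreconnected isPreconnected_univ (mem_univ u)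
      (mem_univ 0) hne h0
  rw [meromorphicOrderAt_eq_top_iff] at hu
  have : f =ᶠ[𝓝[≠] u] g := by
    filter_upwards [hu] with y hy using sub_eq_zero.1 hy
  -- Analyticity of both functions at u fills in the centre of the punctured neighbourhood.
  exact (hfu.frequently_eq_iff_eventually_eq hgu).1 this.frequently

/-- A meromorphic function in normal form is analytic where it does not vanish. -/
lemma analyticAt_of_normalForm_ne_zero {f : ℂ → ℂ} {u : ℂ} (hf : MeromorphicNFAt f u)
    (h : f u ≠ 0) : AnalyticAt ℂ f u := by
  refine hf.meromorphicOrderAt_nonneg_iff_analyticAt.1 ?_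
  rw [hf.meromorphicOrderAt_eq_zero_iff.2 h]

/-- The germs at `0` of the identities `cn² = 1 - sn²`, `dn² = 1 - k² sn²`, `sn' = cn dn`. -/
lemma jacobi_identities_near_zero (k : ℂ) :
    ((fun u => cn k u ^ 2) =ᶠ[𝓝 0] fun u => 1 - sn k u ^ 2) ∧
    ((fun u => dn k u ^ 2) =ᶠ[𝓝 0] fun u => 1 - k ^ 2 * sn k u ^ 2) ∧
    (deriv (sn k) =ᶠ[𝓝 0] fun u => cn k u * dn k u) := by
  have hJ := isJacobiTriple k
  obtain ⟨s, c, d, hs, hc, hd, hs0, -, -, -, hcs, hds, hder, hright⟩ := exists_germ k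
  have hst : Tendsto s (𝓝 0) (𝓝 0) := by simpa [hs0] using hs.continuousAt.tendsto
  -- Put x = s u in sn(F(x)) = x and use F(s u) = u: a left inverse of F agrees with the right
  -- inverse.
  have es : sn k =ᶠ[𝓝 0] s := by
    filter_upwards [hst.eventually hJ.sn_ellipticF, hright] with u h1 h2
    rwa [h2] at h1
  refine ⟨?_, ?_, ?_⟩
  · filter_upwards [hJ.cn_eq] with u hu
    rw [hu, sqrt_mul_self']
  · filter_upwards [hJ.dn_eq] with u hu
    rw [hu, sqrt_mul_self']
  · filter_upwards [es.eventuallyEq_nhds, es, hJ.cn_eq, hJ.dn_eq, hcs, hds, hder] with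
      u h1 h2 h3 h4 h5 h6 h7
    rw [h1.deriv_eq, h7.deriv, h3, h4, h5, h6, h2]

/-- The identities `cn² = 1 - sn²`, `dn² = 1 - k² sn²`, `sn' = cn dn` hold near every point at
which `sn`, `cn`, `dn` are analytic. -/
lemma jacobi_identities {k u : ℂ} (hs : AnalyticAt ℂ (sn k) u) (hc : AnalyticAt ℂ (cn k) u)
    (hd : AnalyticAt ℂ (dn k) u) :
    ((fun u => cn k u ^ 2) =ᶠ[𝓝 u] fun u => 1 - sn k u ^ 2) ∧
    ((fun u => dn k u ^ 2) =ᶠ[𝓝 u] fun u => 1 - k ^ 2 * sn k u ^ 2) ∧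
    (deriv (sn k) =ᶠ[𝓝 u] fun u => cn k u * dn k u) := by
  have hJ := isJacobiTriple k
  have ms := hJ.meromorphic_sn.meromorphicOn
  have mc := hJ.meromorphic_cn.meromorphicOn
  have md := hJ.meromorphic_dn.meromorphicOn
  obtain ⟨h1, h2, h3⟩ := jacobi_identities_near_zero k
  -- The squared relations are continued, because the principal-root relations need not survive away
  -- from 0.
  refine ⟨eventuallyEq_of_germ ?_ ?_ h1 (by fun_prop) (by fun_prop),
    eventuallyEq_of_germ ?_ ?_ h2 (by fun_prop) (by fun_prop),
    eventuallyEq_of_germ ms.deriv (mc.mul md) h3 hs.deriv (by fun_prop)⟩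
  · exact mc.pow 2
  · exact (MeromorphicOn.const 1).sub (ms.pow 2)
  · exact md.pow 2
  · exact (MeromorphicOn.const 1).sub ((MeromorphicOn.const (k ^ 2)).mul (ms.pow 2))

/-- `z = sn²` satisfies `z' = 2 sn cn dn` and
`z'' = 2 (cn² dn² - sn² dn² - k² sn² cn²)`. -/
lemma deriv_sn_sq {k u : ℂ} (s0 : sn k u ≠ 0) (c0 : cn k u ≠ 0) (d0 : dn k u ≠ 0) :
    AnalyticAt ℂ (fun v => sn k v ^ 2) u ∧
    cn k u ^ 2 = 1 - sn k u ^ 2 ∧ dn k u ^ 2 = 1 - k ^ 2 * sn k u ^ 2 ∧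
    deriv (fun v => sn k v ^ 2) u = 2 * sn k u * cn k u * dn k u ∧
    deriv (deriv fun v => sn k v ^ 2) u =
      2 * (cn k u ^ 2 * dn k u ^ 2 - sn k u ^ 2 * dn k u ^ 2
        - k ^ 2 * sn k u ^ 2 * cn k u ^ 2) := by
  have hJ := isJacobiTriple k
  -- A normal form takes the value 0 at a pole, so a nonzero value also says that the function is
  -- finite there.
  have hs := analyticAt_of_normalForm_ne_zero (hJ.meromorphic_sn (mem_univ u)) s0
  have hc := analyticAt_of_normalForm_ne_zero (hJ.meromorphic_cn (mem_univ u)) c0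
  have hd := analyticAt_of_normalForm_ne_zero (hJ.meromorphic_dn (mem_univ u)) d0
  obtain ⟨h1, h2, h3⟩ := jacobi_identities hs hc hd
  have ds : HasDerivAt (sn k) (cn k u * dn k u) u := by
    rw [← h3.eq_of_nhds]
    exact hs.differentiableAt.hasDerivAt
  -- Differentiate cn² = 1 - sn² and cancel cn u ≠ 0; the same is done for dn below.
  have dc : HasDerivAt (cn k) (-(sn k u * dn k u)) u := by
    have a := hc.differentiableAt.hasDerivAt
    have b := (a.pow 2).unique (((ds.pow 2).const_sub 1).congr_of_eventuallyEq h1)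
    have : deriv (cn k) u = -(sn k u * dn k u) := by
      apply mul_left_cancel₀ c0
      push_cast at b
      linear_combination b / 2
    rwa [this] at a
  have dd : HasDerivAt (dn k) (-(k ^ 2 * sn k u * cn k u)) u := by
    have a := hd.differentiableAt.hasDerivAt
    have b := (a.pow 2).unique
      ((((ds.pow 2).const_mul (k ^ 2)).const_sub 1).congr_of_eventuallyEq h2)
    have : deriv (dn k) u = -(k ^ 2 * sn k u * cn k u) := by
      apply mul_left_cancel₀ d0
      push_cast at b
      linear_combination b / 2
    rwa [this] at a
  -- An identity of germs, not just of values at u, since it is differentiated once more.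
  have hz : deriv (fun v => sn k v ^ 2) =ᶠ[𝓝 u] fun v => 2 * sn k v * cn k v * dn k v := by
    filter_upwards [h3, hs.eventually_analyticAt] with v hv hv'
    have := (hv'.differentiableAt.hasDerivAt.pow 2).deriv
    refine this.trans ?_
    rw [hv]
    push_cast
    ring
  refine ⟨by fun_prop, h1.eq_of_nhds, h2.eq_of_nhds, hz.eq_of_nhds, ?_⟩
  rw [hz.deriv_eq]
  refine (((ds.const_mul 2).mul dc).mul dd).deriv.trans ?_
  simp only [Pi.mul_apply]
  ring

end JacobiElliptic

/-! ### Heun's equation under z = sn², and the nonvanishing of z_*. -/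

namespace KNdS

open Filter Topology JacobiElliptic

/-- The second derivative of a composition of analytic functions. -/
lemma deriv_deriv_comp {y z : ℂ → ℂ} {u : ℂ} (hz : AnalyticAt ℂ z u)
    (hy : AnalyticAt ℂ y (z u)) :
    deriv (fun v => y (z v)) u = deriv y (z u) * deriv z u ∧
    deriv (deriv fun v => y (z v)) u =
      deriv (deriv y) (z u) * deriv z u ^ 2 + deriv y (z u) * deriv (deriv z) u := by
  have h1 : deriv (fun v => y (z v)) =ᶠ[𝓝 u] fun v => deriv y (z v) * deriv z v := by
    filter_upwards [hz.continuousAt.eventually hy.eventually_analyticAt,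
      hz.eventually_analyticAt] with v h1 h2
    exact (h1.differentiableAt.hasDerivAt.comp v h2.differentiableAt.hasDerivAt).deriv
  refine ⟨h1.eq_of_nhds, ?_⟩
  rw [h1.deriv_eq]
  have h2 := hy.deriv.differentiableAt.hasDerivAt.comp u hz.differentiableAt.hasDerivAt
  refine (h2.mul hz.deriv.differentiableAt.hasDerivAt).deriv.trans ?_
  simp only [Function.comp]
  ring

/-- The substitution `z = sn²(u, k)`, `k⁻² = A ≠ 0`, turns Heun's equation into its Jacobian
elliptic form. -/
theorem heunEquationAt_iff_jacobiFormAt {A k u : ℂ} (q α β ν₁ ν₂ ν₃ : ℂ)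
    (hA : A ≠ 0) (hk : k ^ (-2 : ℤ) = A)
    (s0 : sn k u ≠ 0) (c0 : cn k u ≠ 0) (d0 : dn k u ≠ 0) :
    (AnalyticAt ℂ (fun v => sn k v ^ 2) u ∧ deriv (fun v => sn k v ^ 2) u ≠ 0) ∧
    ∀ y : ℂ → ℂ, AnalyticAt ℂ y (sn k u ^ 2) →
      (HeunEquationAt A q α β (2 * ν₁ + 1) (2 * ν₂ + 1) (2 * ν₃ + 1) y (sn k u ^ 2) ↔
        JacobiFormAt k q α β ν₁ ν₂ ν₃ (fun v => y (sn k v ^ 2)) u) := by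
  obtain ⟨hz, hc, hd, z1, z2⟩ := deriv_sn_sq s0 c0 d0
  -- With the convention 0⁻¹ = 0, k = 0 would give `k ^ (-2 : ℤ) = 0`, against A ≠ 0.
  have k0 : k ≠ 0 := by
    rintro rfl
    exact hA (by rw [← hk]; simp)
  have hkA : k ^ 2 * A = 1 := by
    rw [← hk, zpow_neg]
    exact mul_inv_cancel₀ (pow_ne_zero 2 k0)
  refine ⟨⟨hz, by rw [z1]; simp [s0, c0, d0]⟩, fun y hy => ?_⟩
  obtain ⟨y1, y2⟩ := deriv_deriv_comp (z := fun v => sn k v ^ 2) hz hy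
  -- These two relations turn Heun's denominators into monomials in sn, cn, dn, so z avoids 0, 1 and
  -- A, and the final comparison is an identity of rational functions.
  have e1 : sn k u ^ 2 - 1 = -cn k u ^ 2 := by rw [hc]; ring
  have e2 : sn k u ^ 2 - A = -(dn k u ^ 2 / k ^ 2) := by
    field_simp
    linear_combination hd - hkA
  unfold HeunEquationAt JacobiFormAt
  rw [y1, y2, z1, z2, e1, e2]
  -- The multiplier is z'².
  have hne : (2 * sn k u * cn k u * dn k u) ^ 2 ≠ 0 := by simp [s0, c0, d0]
  rw [← mul_right_inj' hne, mul_zero]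
  refine Eq.congr ?_ rfl
  field_simp
  ring

/-- The third finite singularity of the radial equation is not `0`. -/
lemma radialZr_ne_zero {rm rp rLm rLp : ℝ} (h : [rm, rp, rLm, rLp].Nodup) :
    (radialZr rm rp rLm rLp : ℂ) ≠ 0 := by
  simp only [List.nodup_cons, List.mem_cons, not_or, List.not_mem_nil] at h
  obtain ⟨⟨h1, h2, h3, -⟩, ⟨h4, -, -⟩, ⟨h5, -⟩, -⟩ := h
  rw [Complex.ofReal_ne_zero, radialZr]
  -- The denominators matter as well as the numerators: a quotient by 0 would have the value 0.
  exact mul_ne_zero (div_ne_zero (sub_ne_zero.2 h4) (sub_ne_zero.2 (Ne.symm h1)))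
    (div_ne_zero (sub_ne_zero.2 (Ne.symm h3)) (sub_ne_zero.2 (Ne.symm h5)))

/-- The third finite singularity of the angular equation is not `0`. -/
lemma angularZ3_ne_zero {Λ a : ℝ} (hΛ : 0 < Λ) (ha : a ≠ 0) : angularZ3 Λ a ≠ 0 := by
  have hpos : 0 < alphaL Λ a := by unfold alphaL; positivity
  have hs : 0 < √(alphaL Λ a) := Real.sqrt_pos.2 hpos
  have hne : (2 * Complex.I * √(alphaL Λ a) : ℂ) ≠ 0 := by
    simp [hs.ne', Complex.I_ne_zero]
  intro h
  have h1 : (alphaL Λ a - 1 : ℂ) / (2 * Complex.I * √(alphaL Λ a)) = 1 := by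
    unfold angularZ3 at h
    linear_combination -2 * h
  rw [div_eq_one_iff_eq hne] at h1
  -- z₃ = 0 means α_Λ - 1 = 2i√α_Λ, a real number equal to a purely imaginary one; imaginary parts
  -- give √α_Λ = 0.
  have := congrArg Complex.im h1
  simp at this
  exact hs.ne' this

end KNdS

/-- Radial part and angular part: at every point `u` where `sn, cn, dn` are finite and nonzero,
`z = sn²(u, k)` is a holomorphic local coordinate, and a function `y` holomorphic at `z` satisfies
Heun's equation at `z` iff `Y(v) = y(sn²(v, k))` satisfies the Jacobian elliptic form at `u`. -/
theorem mainTheorem9 :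
    (∀ (Λ a M e qs rm rp rLm rLp : ℝ) (ω : ℂ) (m : ℤ) (μ₁ μ₂ μ₃ α β q k : ℂ),
      0 < Λ →
      (∀ r : ℝ, KNdS.DeltaR Λ a M e r
        = -(Λ / 3) * ((r - rp) * (r - rm) * (r - rLp) * (r - rLm))) →
      [rm, rp, rLm, rLp].Nodup →
      (μ₁ = KNdS.radialExponent Λ a e qs ω m rm rLm rp rLp ∨
        μ₁ = -KNdS.radialExponent Λ a e qs ω m rm rLm rp rLp) →
      (μ₂ = KNdS.radialExponent Λ a e qs ω m rp rLm rm rLp ∨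
        μ₂ = -KNdS.radialExponent Λ a e qs ω m rp rLm rm rLp) →
      (μ₃ = KNdS.radialExponent Λ a e qs ω m rLp rLm rp rm ∨
        μ₃ = -KNdS.radialExponent Λ a e qs ω m rLp rLm rp rm) →
      k ^ (-2 : ℤ) = (KNdS.radialZr rm rp rLm rLp : ℂ) →
      ∀ u : ℂ, JacobiElliptic.sn k u ≠ 0 → JacobiElliptic.cn k u ≠ 0 →
        JacobiElliptic.dn k u ≠ 0 →
        (AnalyticAt ℂ (fun v => JacobiElliptic.sn k v ^ 2) u ∧
          deriv (fun v => JacobiElliptic.sn k v ^ 2) u ≠ 0) ∧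
        ∀ y : ℂ → ℂ, AnalyticAt ℂ y (JacobiElliptic.sn k u ^ 2) →
          (KNdS.HeunEquationAt (KNdS.radialZr rm rp rLm rLp) q α β
              (2 * μ₁ + 1) (2 * μ₂ + 1) (2 * μ₃ + 1) y (JacobiElliptic.sn k u ^ 2) ↔
            KNdS.JacobiFormAt k q α β μ₁ μ₂ μ₃
              (fun v => y (JacobiElliptic.sn k v ^ 2)) u)) ∧
    (∀ (Λ a : ℝ) (ω Klm : ℂ) (m : ℤ) (α₁ α₂ α₃ α β q k : ℂ),
      0 < Λ → a ≠ 0 →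
      α₁ = KNdS.angularExponent₁ m →
      α₂ = KNdS.angularExponent₁ m →
      (α₃ = KNdS.angularExponent₃ Λ a ω m ∨ α₃ = -KNdS.angularExponent₃ Λ a ω m) →
      q = KNdS.angularQ Λ a ω m Klm α₁ α₂ α₃ →
      α * β = KNdS.angularAlphaBeta Λ a ω m Klm α₁ α₂ α₃ →
      k ^ (-2 : ℤ) = KNdS.angularZ3 Λ a →
      ∀ u : ℂ, JacobiElliptic.sn k u ≠ 0 → JacobiElliptic.cn k u ≠ 0 →
        JacobiElliptic.dn k u ≠ 0 →
        (AnalyticAt ℂ (fun v => JacobiElliptic.sn k v ^ 2) u ∧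
          deriv (fun v => JacobiElliptic.sn k v ^ 2) u ≠ 0) ∧
        ∀ y : ℂ → ℂ, AnalyticAt ℂ y (JacobiElliptic.sn k u ^ 2) →
          (KNdS.HeunEquationAt (KNdS.angularZ3 Λ a) q α β
              (2 * α₁ + 1) (2 * α₂ + 1) (2 * α₃ + 1) y (JacobiElliptic.sn k u ^ 2) ↔
            KNdS.JacobiFormAt k q α β α₁ α₂ α₃
              (fun v => y (JacobiElliptic.sn k v ^ 2)) u)) := by
  refine ⟨?_, ?_⟩
  · intro Λ a M e qs rm rp rLm rLp ω m μ₁ μ₂ μ₃ α β q k _ _ hnd _ _ _ hk u s0 c0 d0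
    exact KNdS.heunEquationAt_iff_jacobiFormAt q α β μ₁ μ₂ μ₃ (KNdS.radialZr_ne_zero hnd) hk
      s0 c0 d0
  · intro Λ a ω Klm m α₁ α₂ α₃ α β q k hΛ ha _ _ _ _ _ hk u s0 c0 d0
    exact KNdS.heunEquationAt_iff_jacobiFormAt q α β α₁ α₂ α₃ (KNdS.angularZ3_ne_zero hΛ ha) hk
      s0 c0 d0
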